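/- Chomp on a finite graph $G$ is the following game. Players $A$ and $B$ alternately move, with $A$ first; a move removes from the current graph either an edge, or a vertex together with all edges incident to it. The player who cannot move (because the remaining graph is empty) loses. (Equivalently, it is chomp on the poset of faces of $G$ — the empty set, the vertices and the edges, ordered by inclusion — where a move picks an element and removes everything above it, and whoever is forced to pick the empty set loses.) For integers $n,k\ge 0$ and $0\le i_1,\dots,i_k\le n$, let $\mathcal K_n^{i_1,\dots,i_k}$ be the graph that consists of a clique on $u_1,\dots,u_n$ and $k$ further, pairwise non-adjacent vertices, the $j$-th of which is adjacent exactly to $u_1,\dots,u_{i_j}$. **Theorem.** Let $n\ge i\ge 0$ be integers. All pairs of residues below are modulo $3$. 1. If $(n,i)\equiv(1,0)$ or $(n,i)\equiv(2,2)$, then player $B$ has a winning strategy for chomp on $\mathcal K_n^{i}$; otherwise player $A$ has one. 2. If $(n,i)\equiv(0,0)$ or $(n,i)\equiv(2,1)$, then player $B$ has a winning strategy for chomp on $\mathcal K_n^{0,i}$; otherwise player $A$ has one. 3. If $n\ge 1$ and $(n,i)$ is congruent to one of $(0,0)$, $(0,2)$, $(1,0)$, $(1,1)$, $(2,1)$,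 $(2,2)$, then player $A$ has a winning strategy for chomp on $\mathcal K_n^{1,i}$. 4. If $(n,i)\equiv(1,0)$ or $(n,i)\equiv(2,2)$, then for every $j$ with $0\le j\le n$ player $A$ has a winning strategy for chomp on $\mathcal K_n^{j,i}$. -/

import Mathlib

/-- The two players of the game; `A` is the first player. -/
inductive ChompPlayer
  | A
  | B

namespace Chomp

/-- The elements of `P` that remain after the picks listed in `h` (most recent pick first):
each pick `x` removes its up-set. -/
def remaining {P : Type*} [PartialOrder P] (h : List P) : Set P :=
  {y | ∀ x ∈ h, ¬ x ≤ y}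

/-- After the history `h`, the element `x` is a safe pick: it is still present and it is not
the global minimum. A player without a safe pick is forced to pick `⊥`, and loses. -/
def IsMove {P : Type*} [PartialOrder P] [OrderBot P] (h : List P) (x : P) : Prop :=
  x ∈ remaining h ∧ x ≠ ⊥

/-- The player who is to pick after the history `h`; `A` starts and the players alternate. -/
def toMove {P : Type*} (h : List P) : ChompPlayer :=
  if Even h.length then ChompPlayer.A else ChompPlayer.B

/-- `IsPlay p σ h`: the history `h` can arise when the player `p` follows the strategy `σ`
(a function that prescribes a pick after every history) and the opponent picks freely. -/
inductive IsPlay {P : Type*} [PartialOrder P] [OrderBot P]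
    (p : ChompPlayer) (σ : List P → P) : List P → Prop
  | nil : IsPlay p σ []
  | cons (h : List P) (x : P) : IsPlay p σ h → IsMove h x → (toMove h = p → x = σ h) →
      IsPlay p σ (x :: h)

/-- The strategy `σ` wins for `p`: whatever the opponent does, whenever it is the turn of `p`,
`σ` prescribes a safe pick. On a finite poset every play ends, so it is then the opponent
who is forced to pick `⊥`. -/
def IsWinningStrategy {P : Type*} [PartialOrder P] [OrderBot P]
    (p : ChompPlayer) (σ : List P → P) : Prop :=
  ∀ h : List P, IsPlay p σ h → toMove h = p → IsMove h (σ h)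

/-- The player `p` has a winning strategy for chomp on the finite poset `P`. -/
def HasWinningStrategy (P : Type*) [PartialOrder P] [OrderBot P] [Finite P]
    (p : ChompPlayer) : Prop :=
  ∃ σ : List P → P, IsWinningStrategy p σ

/-- The faces of a graph regarded as a simplicial complex: the empty set, the singletons `{v}`
of vertices, and the pairs `{u, v}` of adjacent vertices, ordered by inclusion. -/
def Face {V : Type*} (G : SimpleGraph V) : Type _ :=
  {s : Finset V // s = ∅ ∨ (∃ v, s = {v}) ∨ ∃ u v, G.Adj u v ∧ (s : Set V) = {u, v}}

instance {V : Type*} (G : SimpleGraph V) : PartialOrder (Face G) :=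
  inferInstanceAs (PartialOrder (Subtype _))

instance {V : Type*} (G : SimpleGraph V) : OrderBot (Face G) where
  bot := ⟨∅, Or.inl rfl⟩
  bot_le s := Finset.empty_subset s.1

instance {V : Type*} [Finite V] (G : SimpleGraph V) : Finite (Face G) :=
  inferInstanceAs (Finite (Subtype _))

/-- The player `p` has a winning strategy for chomp on the finite graph `G`: the players
alternately remove a vertex with its incident edges, or an edge, and whoever cannot move
loses. -/
def WinsOn {V : Type*} [Finite V] (G : SimpleGraph V) (p : ChompPlayer) : Prop :=
  HasWinningStrategy (Face G) p

/-- The graph `K_n^{i_1, ..., i_k}`: a clique on `u_1, ..., u_n` (here `Sum.inl 0`, ...,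
`Sum.inl (n - 1)`) and `k` further vertices (the `Sum.inr j`), pairwise non-adjacent, the
`j`-th of which is adjacent exactly to the first `i j` vertices of the clique. It is meant
for `i j ≤ n`. -/
def thresholdGraph (n : ℕ) {k : ℕ} (i : Fin k → ℕ) : SimpleGraph (Fin n ⊕ Fin k) where
  Adj
    | Sum.inl a, Sum.inl b => a ≠ b
    | Sum.inl a, Sum.inr j => (a : ℕ) < i j
    | Sum.inr j, Sum.inl a => (a : ℕ) < i j
    | Sum.inr _, Sum.inr _ => False
  symm := ⟨by
    rintro (a | j) (b | l) h
    · exact Ne.symm h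
    · exact h
    · exact h
    · exact h⟩
  loopless := ⟨by
    rintro (a | j) h
    · exact h rfl
    · exact h⟩

end Chomp

/-!
The proof determines all the positions that matter by one symmetry principle: if an involutive
automorphism of a graph moves no vertex to a neighbour, then the graph has the same outcome as the
subgraph induced on the fixed vertices, since a move outside the fixed subgraph can be answered by
its mirror image (`Chomp.secondWins_iff_fixed`). In particular two non-adjacent vertices with the
same neighbours can be removed together (`Chomp.secondWins_erase_twins`).

Hence removing an edge from a clique amounts to removing its two ends, and a clique is lost for
the player to move exactly if its size is divisible by `3`. Isolated vertices cancel in pairs; one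
remaining isolated vertex shifts the residue
(`Chomp.IsCliqueWithIsolated.secondWins_iff`). The same idea treats a clique `Q` with isolated
vertices and one vertex `w` adjacent to a subset `I` of `Q`
(`Chomp.IsCliqueWithVertex.secondWins_iff`): every move leads to a position of the same kind,
except for the removal of an edge `ab` with `a ∈ I` and `b ∉ I`. Such a move, made from one of
the positions claimed to be lost, is refuted by removing `w`, which leaves a clique without an
edge, or by removing the edge `wa`, which turns `a` and `b` into twins.

This covers the graphs `K_n^i` and `K_n^{0,i}`. On the remaining graphs the first player wins by
moving to one of the lost positions of this kind: by removing an attached vertex, the only edge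
at the attached vertex of degree one, or `u_1`.

Positions are pairs of a vertex set and an adjacency relation (`Chomp.SecondWins`), which
`Chomp.winsOn_A_iff` and `Chomp.winsOn_B_iff` relate to strategies for chomp on the face poset.
-/

namespace Chomp

/-! ### Strategies and outcomes on a finite poset -/

theorem remaining_nil {P : Type*} [PartialOrder P] : remaining ([] : List P) = Set.univ := by
  simp [remaining]

theorem remaining_cons {P : Type*} [PartialOrder P] (x : P) (h : List P) :
    remaining (x :: h) = remaining h \ Set.Ici x := by
  ext y
  simp [remaining, and_comm]

theorem toMove_cons {P : Type*} (x : P) (h : List P) (p : ChompPlayer) :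
    toMove (x :: h) = p ↔ toMove h ≠ p := by
  by_cases he : Even h.length <;> cases p <;> simp [toMove, he, Nat.even_add_one]

/-- A labelling of the sets of remaining elements by `win` (the player to pick wins) and `lose`,
closed under the rules of the game, yields a winning strategy. Only positions that occur in play
need a label, and nothing is required of picks of `⊥`. -/
theorem hasWinningStrategy_of_invariant {P : Type*} [PartialOrder P] [OrderBot P] [Finite P]
    (win lose : Set P → Prop)
    (hlose : ∀ R x, lose R → x ∈ R → x ≠ ⊥ → win (R \ Set.Ici x))
    (hwin : ∀ R, win R → ∃ x ∈ R, x ≠ ⊥ ∧ lose (R \ Set.Ici x)) (p : ChompPlayer)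
    (hA : p = ChompPlayer.A → win Set.univ) (hB : p = ChompPlayer.B → lose Set.univ) :
    HasWinningStrategy P p := by
  classical
  let σ : List P → P := fun h => if hw : win (remaining h) then (hwin _ hw).choose else ⊥
  have hσ : ∀ h, win (remaining h) →
      σ h ∈ remaining h ∧ σ h ≠ ⊥ ∧ lose (remaining h \ Set.Ici (σ h)) := by
    intro h hw
    have := (hwin _ hw).choose_spec
    simpa only [σ, dif_pos hw] using this
  -- `p` always moves from a `win` position and the opponent from a `lose` position
  have inv : ∀ h, IsPlay p σ h →
      if toMove h = p then win (remaining h) else lose (remaining h) := by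
    intro h hplay
    induction hplay with
    | nil => cases p <;> simp [toMove, remaining_nil, hA, hB]
    | cons h x _ hx hfollow ih =>
      rw [remaining_cons]
      by_cases ht : toMove h = p
      · rw [if_pos ht] at ih
        rw [if_neg (by rw [toMove_cons]; exact not_not_intro ht), hfollow ht]
        exact (hσ h ih).2.2
      · rw [if_neg ht] at ih
        rw [if_pos ((toMove_cons x h p).2 ht)]
        exact hlose _ _ ih hx.1 hx.2
  refine ⟨σ, fun h hplay ht => ?_⟩
  have hw := inv h hplay
  rw [if_pos ht] at hw
  exact ⟨(hσ h hw).1, (hσ h hw).2.1⟩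

/-- Played against each other, two winning strategies would produce an infinite play, but the set
of remaining elements shrinks with every pick. -/
theorem not_both_hasWinningStrategy {P : Type*} [PartialOrder P] [OrderBot P] [Finite P]
    (hA : HasWinningStrategy P ChompPlayer.A) (hB : HasWinningStrategy P ChompPlayer.B) :
    False := by
  obtain ⟨σ, hσ⟩ := hA
  obtain ⟨τ, hτ⟩ := hB
  suffices ∀ (m : ℕ) (h : List P), (remaining h).ncard = m → IsPlay ChompPlayer.A σ h →
      IsPlay ChompPlayer.B τ h → False from this _ [] rfl .nil .nil
  intro m
  induction m using Nat.strong_induction_on with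
  | _ m ih =>
    intro h hm hpA hpB
    have step : ∀ x, IsMove h x → (toMove h = ChompPlayer.A → x = σ h) →
        (toMove h = ChompPlayer.B → x = τ h) → False := by
      intro x hx h1 h2
      refine ih _ ?_ (x :: h) rfl (.cons h x hpA hx h1) (.cons h x hpB hx h2)
      rw [← hm, remaining_cons]
      exact Set.ncard_lt_ncard
        ⟨Set.sdiff_subset, fun hsub => (hsub hx.1).2 Set.self_mem_Ici⟩
    cases ht : toMove h with
    | A => exact step (σ h) (hσ h hpA ht) (fun _ => rfl) (by simp [ht])
    | B => exact step (τ h) (hτ h hpB ht) (by simp [ht]) (fun _ => rfl)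

/-! ### Positions of graph chomp -/

section Position

theorem ncard_edgeSet_deleteEdge_lt {V : Type*} [Finite V] {H : SimpleGraph V} {u v : V}
    (huv : H.Adj u v) :
    (H.deleteEdges {s(u, v)}).edgeSet.ncard < H.edgeSet.ncard := by
  refine Set.ncard_lt_ncard ?_
  rw [SimpleGraph.edgeSet_deleteEdges]
  exact ⟨Set.sdiff_subset, fun hsub => (hsub (a := s(u, v)) huv).2 rfl⟩

/-- The position with vertex set `S` and the edges of `H` inside `S` is lost for the player to
move. Edges of `H` that leave `S` play no role: deleting a vertex shrinks `S` and leaves `H`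
unchanged. -/
def SecondWins {V : Type*} [DecidableEq V] [Finite V] (S : Finset V) (H : SimpleGraph V) : Prop :=
  (∀ v, v ∈ S → ¬ SecondWins (S.erase v) H) ∧
    ∀ u v, u ∈ S → v ∈ S → H.Adj u v → ¬ SecondWins S (H.deleteEdges {s(u, v)})
termination_by S.card + H.edgeSet.ncard
decreasing_by
  · have := Finset.card_erase_lt_of_mem ‹v ∈ S›
    omega
  · have := ncard_edgeSet_deleteEdge_lt ‹H.Adj u v›
    omega

variable {V : Type*} [DecidableEq V]

/-- The faces of `G` that are present in the position given by the vertex set `S` and the edges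
of `H` inside `S`. The empty face is always present. -/
def faces (G : SimpleGraph V) (S : Finset V) (H : SimpleGraph V) : Set (Face G) :=
  {s | s.1 ⊆ S ∧ ∀ u ∈ s.1, ∀ v ∈ s.1, u ≠ v → H.Adj u v}

theorem faces_diff_vertex {G H : SimpleGraph V} {S : Finset V} {v : V} (x : Face G)
    (hx : x.1 = {v}) :
    faces G S H \ Set.Ici x = faces G (S.erase v) H := by
  ext y
  have hxy : x ≤ y ↔ v ∈ y.1 := by
    change x.1 ⊆ y.1 ↔ _
    rw [hx, Finset.singleton_subset_iff]
  simp only [faces, Set.mem_sdiff, Set.mem_ofPred_eq, Set.mem_Ici, hxy, Finset.subset_erase]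
  tauto

theorem faces_diff_edge {G H : SimpleGraph V} {S : Finset V} {u v : V} (huv : u ≠ v)
    (x : Face G) (hx : x.1 = {u, v}) :
    faces G S H \ Set.Ici x = faces G S (H.deleteEdges {s(u, v)}) := by
  ext y
  have hxy : x ≤ y ↔ u ∈ y.1 ∧ v ∈ y.1 := by
    change x.1 ⊆ y.1 ↔ _
    rw [hx, Finset.insert_subset_iff, Finset.singleton_subset_iff]
  simp only [faces, Set.mem_sdiff, Set.mem_ofPred_eq, Set.mem_Ici, hxy,
    SimpleGraph.deleteEdges_adj, Set.mem_singleton_iff, Sym2.eq_iff]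
  constructor
  · rintro ⟨⟨h1, h2⟩, h3⟩
    refine ⟨h1, fun a ha b hb hab => ⟨h2 a ha b hb hab, ?_⟩⟩
    rintro (⟨rfl, rfl⟩ | ⟨rfl, rfl⟩)
    · exact h3 ⟨ha, hb⟩
    · exact h3 ⟨hb, ha⟩
  · rintro ⟨h1, h2⟩
    exact ⟨⟨h1, fun a ha b hb hab => (h2 a ha b hb hab).1⟩,
      fun h => (h2 u h.1 v h.2 huv).2 (Or.inl ⟨rfl, rfl⟩)⟩

variable [Finite V]

theorem secondWins_iff {S : Finset V} {H : SimpleGraph V} : SecondWins S H ↔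
    (∀ v ∈ S, ¬ SecondWins (S.erase v) H) ∧
      ∀ u ∈ S, ∀ v ∈ S, H.Adj u v → ¬ SecondWins S (H.deleteEdges {s(u, v)}) := by
  rw [SecondWins]
  tauto

theorem not_secondWins_of_vertex {S : Finset V} {H : SimpleGraph V} {v : V} (hv : v ∈ S)
    (h : SecondWins (S.erase v) H) : ¬ SecondWins S H :=
  fun hS => (secondWins_iff.1 hS).1 v hv h

theorem not_secondWins_of_edge {S : Finset V} {H : SimpleGraph V} {u v : V} (hu : u ∈ S)
    (hv : v ∈ S) (huv : H.Adj u v) (h : SecondWins S (H.deleteEdges {s(u, v)})) :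
    ¬ SecondWins S H :=
  fun hS => (secondWins_iff.1 hS).2 u hu v hv huv h

theorem winsOn_of_secondWins (G : SimpleGraph V) (S : Finset V) (hS : ∀ v, v ∈ S)
    (p : ChompPlayer) (hA : p = ChompPlayer.A → ¬ SecondWins S G)
    (hB : p = ChompPlayer.B → SecondWins S G) : WinsOn G p := by
  have huniv : faces G S G = Set.univ := by
    refine Set.eq_univ_of_forall fun s => ⟨fun v _ => hS v, ?_⟩
    obtain ⟨s, rfl | ⟨v, rfl⟩ | ⟨u, v, huv, hs⟩⟩ := s
    · simp
    · simp
    · intro a ha b hb hab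
      have ha' : a ∈ (s : Set V) := ha
      have hb' : b ∈ (s : Set V) := hb
      rw [hs] at ha' hb'
      rcases ha' with rfl | rfl <;> rcases hb' with rfl | rfl
      · exact absurd rfl hab
      · exact huv
      · exact huv.symm
      · exact absurd rfl hab
  refine hasWinningStrategy_of_invariant
    (fun R => ∃ S H, H ≤ G ∧ R = faces G S H ∧ ¬ SecondWins S H)
    (fun R => ∃ S H, H ≤ G ∧ R = faces G S H ∧ SecondWins S H) ?_ ?_ p
    (fun h => ⟨S, G, le_rfl, huniv.symm, hA h⟩) (fun h => ⟨S, G, le_rfl, huniv.symm, hB h⟩)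
  · rintro _ x ⟨S, H, hHG, rfl, hSW⟩ hx hbot
    obtain ⟨s, hs⟩ := x
    rcases id hs with h0 | ⟨v, hv⟩ | ⟨u, v, huv, huvs⟩
    · exact absurd (Subtype.ext h0) hbot
    · refine ⟨_, H, hHG, faces_diff_vertex _ hv, (secondWins_iff.1 hSW).1 v ?_⟩
      exact hx.1 (by simp [hv])
    · have hs' : s = {u, v} := by
        apply Finset.coe_injective
        rw [huvs]
        simp
      subst hs'
      refine ⟨S, _, (SimpleGraph.deleteEdges_le _).trans hHG, faces_diff_edge huv.ne _ rfl,
        (secondWins_iff.1 hSW).2 u (hx.1 (by simp)) v (hx.1 (by simp)) ?_⟩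
      exact hx.2 u (by simp) v (by simp) huv.ne
  · rintro _ ⟨S, H, hHG, rfl, hSW⟩
    rw [secondWins_iff, not_and_or] at hSW
    push Not at hSW
    rcases hSW with ⟨v, hv, hw⟩ | ⟨u, hu, v, hv, huv, hw⟩
    · let x : Face G := ⟨{v}, Or.inr (Or.inl ⟨v, rfl⟩)⟩
      refine ⟨x, ⟨by simpa [x] using hv, by simp [x]⟩, fun h => ?_,
        _, H, hHG, faces_diff_vertex x rfl, hw⟩
      exact Finset.singleton_ne_empty v (congrArg Subtype.val h)
    · let x : Face G := ⟨{u, v}, Or.inr (Or.inr ⟨u, v, hHG huv, by simp⟩)⟩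
      refine ⟨x, ⟨?_, ?_⟩, fun h => ?_,
        S, _, (SimpleGraph.deleteEdges_le _).trans hHG, faces_diff_edge huv.ne x rfl, hw⟩
      · simp [x, Finset.insert_subset_iff, hu, hv]
      · simp [x, huv, huv.symm]
      · exact Finset.insert_ne_empty u {v} (congrArg Subtype.val h)

theorem winsOn_B_iff {G : SimpleGraph V} {S : Finset V} (hS : ∀ v, v ∈ S) :
    WinsOn G ChompPlayer.B ↔ SecondWins S G := by
  refine ⟨fun hB => ?_, fun h => winsOn_of_secondWins G S hS _ (by simp [h]) (by simp [h])⟩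
  by_contra h
  exact not_both_hasWinningStrategy (winsOn_of_secondWins G S hS .A (by simp [h]) (by simp)) hB

theorem winsOn_A_iff {G : SimpleGraph V} {S : Finset V} (hS : ∀ v, v ∈ S) :
    WinsOn G ChompPlayer.A ↔ ¬ SecondWins S G := by
  refine ⟨fun hA h => ?_, fun h => winsOn_of_secondWins G S hS _ (by simp [h]) (by simp [h])⟩
  exact not_both_hasWinningStrategy hA (winsOn_of_secondWins G S hS .B (by simp) (by simp [h]))

/-- Let `τ` be an involutive automorphism of a position that moves no vertex to a neighbour. Then
the outcome is that of the subgraph induced on the fixed vertices: a move outside it can be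
answered by its mirror image. Since `F` only has to agree with `H` on the fixed vertices, the case
`τ = id` says that the outcome depends only on the edges inside `S`. -/
theorem secondWins_iff_fixed {S T : Finset V} {H F : SimpleGraph V} {τ : V → V}
    (hτ : τ.Involutive) (hS : ∀ v ∈ S, τ v ∈ S)
    (hadj : ∀ u ∈ S, ∀ v ∈ S, H.Adj u v → H.Adj (τ u) (τ v))
    (hnon : ∀ v ∈ S, ¬ H.Adj v (τ v))
    (hT : ∀ v, v ∈ T ↔ v ∈ S ∧ τ v = v)
    (hF : ∀ u ∈ T, ∀ v ∈ T, F.Adj u v ↔ H.Adj u v) :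
    SecondWins S H ↔ SecondWins T F := by
  induction hm : S.card + H.edgeSet.ncard using Nat.strong_induction_on
    generalizing S T H F with
  | _ m ih =>
    subst hm
    -- a move on the fixed subgraph leaves `τ` a symmetry, and can be made on both sides
    have hvert : ∀ v ∈ T, (SecondWins (S.erase v) H ↔ SecondWins (T.erase v) F) := by
      intro v hv
      have hv' := (hT v).1 hv
      have hlt := Finset.card_erase_lt_of_mem hv'.1
      refine ih _ (by omega) ?_ ?_ ?_ ?_ ?_ rfl
      · intro a ha
        rw [Finset.mem_erase] at ha ⊢
        exact ⟨fun h => ha.1 (by rw [← hτ a, h, hv'.2]), hS a ha.2⟩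
      · exact fun a ha b hb => hadj a (Finset.mem_of_mem_erase ha) b (Finset.mem_of_mem_erase hb)
      · exact fun a ha => hnon a (Finset.mem_of_mem_erase ha)
      · intro a
        simp only [Finset.mem_erase, hT]
        tauto
      · exact fun a ha b hb => hF a (Finset.mem_of_mem_erase ha) b (Finset.mem_of_mem_erase hb)
    have hedge : ∀ u ∈ T, ∀ v ∈ T, H.Adj u v → (SecondWins S (H.deleteEdges {s(u, v)}) ↔
        SecondWins T (F.deleteEdges {s(u, v)})) := by
      intro u hu v hv huv
      have hu' := (hT u).1 hu
      have hv' := (hT v).1 hv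
      have hlt := ncard_edgeSet_deleteEdge_lt huv
      refine ih _ (by omega) hS ?_ ?_ hT ?_ rfl
      · intro a ha b hb
        simp only [SimpleGraph.deleteEdges_adj, Set.mem_singleton_iff]
        rintro ⟨hab, hne⟩
        refine ⟨hadj a ha b hb hab, fun h => hne ?_⟩
        have := congrArg (Sym2.map τ) h
        simpa [hτ a, hτ b, hu'.2, hv'.2] using this
      · intro a ha h
        exact hnon a ha h.1
      · intro a ha b hb
        simp [hF a ha b hb]
    constructor
    · intro h
      rw [secondWins_iff] at h ⊢
      refine ⟨fun v hv => ?_, fun u hu v hv huv => ?_⟩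
      · rw [← hvert v hv]
        exact h.1 v ((hT v).1 hv).1
      · have huv' := (hF u hu v hv).1 huv
        rw [← hedge u hu v hv huv']
        exact h.2 u ((hT u).1 hu).1 v ((hT v).1 hv).1 huv'
    · intro h
      have h' := secondWins_iff.1 h
      refine secondWins_iff.2 ⟨fun v hv => ?_, fun u hu v hv huv => ?_⟩
      · by_cases hfix : τ v = v
        · have hvT := (hT v).2 ⟨hv, hfix⟩
          rw [hvert v hvT]
          exact h'.1 v hvT
        · have hmem : τ v ∈ S.erase v := Finset.mem_erase.2 ⟨hfix, hS v hv⟩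
          -- answer the removal of `v` by that of its mirror image
          refine not_secondWins_of_vertex hmem ?_
          have hlt := Finset.card_erase_lt_of_mem hv
          have hlt' := Finset.card_erase_lt_of_mem hmem
          refine (ih _ (by omega) ?_ ?_ ?_ ?_ hF rfl).2 h
          · intro a ha
            simp only [Finset.mem_erase] at ha ⊢
            exact ⟨fun e => ha.2.1 (hτ.injective e),
              fun e => ha.1 (by rw [← e, hτ]), hS a ha.2.2⟩
          · intro a ha b hb
            simp only [Finset.mem_erase] at ha hb
            exact hadj a ha.2.2 b hb.2.2
          · intro a ha
            simp only [Finset.mem_erase] at ha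
            exact hnon a ha.2.2
          · intro a
            simp only [Finset.mem_erase, hT]
            constructor
            · rintro ⟨ha, hfa⟩
              refine ⟨⟨?_, ?_, ha⟩, hfa⟩
              · rintro rfl
                exact hfix (by rw [hτ] at hfa; exact hfa.symm)
              · rintro rfl
                exact hfix hfa
            · tauto
      · by_cases hfix : τ u = u ∧ τ v = v
        · have huT := (hT u).2 ⟨hu, hfix.1⟩
          have hvT := (hT v).2 ⟨hv, hfix.2⟩
          rw [hedge u huT v hvT huv]
          exact h'.2 u huT v hvT ((hF u huT v hvT).2 huv)
        -- `τ` fixes the edge only if it fixes both ends: it cannot swap adjacent vertices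
        · have hne : s(τ u, τ v) ≠ s(u, v) := by
            rw [Ne, Sym2.eq_iff]
            rintro (e | ⟨e, -⟩)
            · exact hfix e
            · exact hnon u hu (e ▸ huv)
          have hadj' : (H.deleteEdges {s(u, v)}).Adj (τ u) (τ v) := by
            rw [SimpleGraph.deleteEdges_adj]
            exact ⟨hadj u hu v hv huv, hne⟩
          refine not_secondWins_of_edge (hS u hu) (hS v hv) hadj' ?_
          have hlt := ncard_edgeSet_deleteEdge_lt huv
          have hlt' := ncard_edgeSet_deleteEdge_lt hadj'
          refine (ih _ (by omega) hS ?_ ?_ hT ?_ rfl).2 h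
          · intro a ha b hb
            simp only [SimpleGraph.deleteEdges_adj, Set.mem_singleton_iff]
            rintro ⟨⟨hab, h1⟩, h2⟩
            refine ⟨⟨hadj a ha b hb hab, fun e => h2 ?_⟩, fun e => h1 ?_⟩
            · simpa [hτ a, hτ b] using congrArg (Sym2.map τ) e
            · simpa [hτ a, hτ b, hτ u, hτ v] using congrArg (Sym2.map τ) e
          · exact fun a ha hab => hnon a ha hab.1.1
          · intro a ha b hb
            rw [hF a ha b hb]
            have ha' := ((hT a).1 ha).2
            have hb' := ((hT b).1 hb).2
            simp only [SimpleGraph.deleteEdges_adj, Set.mem_singleton_iff]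
            refine ⟨fun hab => ⟨⟨hab, ?_⟩, ?_⟩, fun hab => hab.1.1⟩
            · rw [Sym2.eq_iff]
              rintro (⟨rfl, rfl⟩ | ⟨rfl, rfl⟩)
              · exact hfix ⟨ha', hb'⟩
              · exact hfix ⟨hb', ha'⟩
            · rw [Sym2.eq_iff]
              rintro (⟨rfl, rfl⟩ | ⟨rfl, rfl⟩)
              · exact hfix ⟨by simpa [hτ u] using ha'.symm, by simpa [hτ v] using hb'.symm⟩
              · exact hfix ⟨by simpa [hτ u] using hb'.symm, by simpa [hτ v] using ha'.symm⟩

/-- Two non-adjacent vertices with the same neighbours can be removed together without changing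
the outcome. -/
theorem secondWins_erase_twins {S T : Finset V} {H : SimpleGraph V} {a b : V}
    (ha : a ∈ S) (hb : b ∈ S) (hab : ¬ H.Adj a b)
    (htwin : ∀ c ∈ S, c ≠ a → c ≠ b → (H.Adj a c ↔ H.Adj b c))
    {F : SimpleGraph V} (hT : ∀ v, v ∈ T ↔ v ∈ S ∧ v ≠ a ∧ v ≠ b)
    (hF : ∀ u ∈ T, ∀ v ∈ T, F.Adj u v ↔ H.Adj u v) (hne : a ≠ b) :
    SecondWins S H ↔ SecondWins T F := by
  refine secondWins_iff_fixed (τ := Equiv.swap a b) (fun v => by simp) ?_ ?_ ?_ ?_ hF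
  · intro v hv
    rw [Equiv.swap_apply_def]
    split_ifs <;> assumption
  · intro u hu v hv huv
    have := huv.ne
    simp only [Equiv.swap_apply_def]
    split_ifs with h1 h2 h3 h4 h5 h6 <;> subst_vars
    · exact absurd rfl this
    · exact absurd huv hab
    · exact (htwin v hv h2 h3).1 huv
    · exact absurd huv.symm hab
    · exact absurd rfl this
    · exact (htwin v hv h5 h6).2 huv
    · exact ((htwin u hu h1 h4).1 huv.symm).symm
    · exact ((htwin u hu h1 h4).2 huv.symm).symm
    · exact huv
  · intro v hv
    simp only [Equiv.swap_apply_def]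
    split_ifs with h1 h2 <;> subst_vars
    · exact hab
    · exact fun h => hab h.symm
    · exact SimpleGraph.irrefl _
  · intro v
    rw [hT, Equiv.swap_apply_def]
    split_ifs with h1 h2
    · simp [h1, hne.symm]
    · simp [h2, hne]
    · simp [h1, h2]

end Position

/-! ### A clique with isolated vertices and one attached vertex -/

section Outcomes

/-- The position on the vertex set `S` with the edges of `H` consists of a clique on `Q` and a set
`Z` of isolated vertices. -/
structure IsCliqueWithIsolated {V : Type*} (H : SimpleGraph V) (S Z Q : Finset V) : Prop where
  mem_iff : ∀ v, v ∈ S ↔ v ∈ Z ∨ v ∈ Q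
  disjoint : ∀ z ∈ Z, z ∉ Q
  isolated : ∀ z ∈ Z, ∀ v ∈ S, ¬ H.Adj z v
  clique : ∀ a ∈ Q, ∀ b ∈ Q, a ≠ b → H.Adj a b

/-- The position on the vertex set `S` with the edges of `H` consists of a clique on `Q`, a set `Z`
of isolated vertices, and a further vertex `w` whose neighbourhood is the subset `I` of `Q`. -/
structure IsCliqueWithVertex {V : Type*} (H : SimpleGraph V) (S Z Q I : Finset V) (w : V) :
    Prop where
  mem_iff : ∀ v, v ∈ S ↔ v = w ∨ v ∈ Z ∨ v ∈ Q
  disjoint : ∀ z ∈ Z, z ∉ Q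
  notMem_isolated : w ∉ Z
  notMem_clique : w ∉ Q
  subset : ∀ a ∈ I, a ∈ Q
  isolated : ∀ z ∈ Z, ∀ v ∈ S, ¬ H.Adj z v
  clique : ∀ a ∈ Q, ∀ b ∈ Q, a ≠ b → H.Adj a b
  adj_iff : ∀ a ∈ Q, H.Adj w a ↔ a ∈ I

variable {V : Type*} {H : SimpleGraph V} {S Z Q I : Finset V} {w : V}

/-- Up to orientation, an edge either meets `w` or lies in the clique; in the latter case it can
be oriented so that its first end is in `I` whenever one of its ends is. -/
theorem IsCliqueWithVertex.edge_cases (h : IsCliqueWithVertex H S Z Q I w) {u v : V}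
    (hu : u ∈ S) (hv : v ∈ S) (huv : H.Adj u v) :
    (∃ a ∈ I, s(u, v) = s(w, a)) ∨
      ∃ a ∈ Q, ∃ b ∈ Q, a ≠ b ∧ s(u, v) = s(a, b) ∧ (b ∈ I → a ∈ I) := by
  have := SimpleGraph.adj_comm H
  have hne := huv.ne
  obtain ⟨h1, h2, h3, h4, h5, h6, h7, h8⟩ := h
  simp only [Sym2.eq_iff]
  grind

variable [DecidableEq V]

namespace IsCliqueWithIsolated

theorem erase_isolated (h : IsCliqueWithIsolated H S Z Q) {z : V} (hz : z ∈ Z) :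
    IsCliqueWithIsolated H (S.erase z) (Z.erase z) Q := by
  obtain ⟨h1, h2, h3, h4⟩ := h
  constructor <;> grind

theorem erase_clique (h : IsCliqueWithIsolated H S Z Q) {a : V} (ha : a ∈ Q) :
    IsCliqueWithIsolated H (S.erase a) Z (Q.erase a) := by
  obtain ⟨h1, h2, h3, h4⟩ := h
  constructor <;> grind

/-- After the removal of the edge `ab` of the clique, `a` and `b` are twins. -/
theorem deleteEdge_iff [Finite V] (h : IsCliqueWithIsolated H S Z Q) {a b : V} (ha : a ∈ Q)
    (hb : b ∈ Q) (hab : a ≠ b) :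
    SecondWins S (H.deleteEdges {s(a, b)}) ↔ SecondWins ((S.erase a).erase b) H := by
  obtain ⟨h1, h2, h3, h4⟩ := h
  refine secondWins_erase_twins (a := a) (b := b) ?_ ?_ ?_ ?_ ?_ ?_ hab
  · grind
  · grind
  · simp
  · intro c hc hca hcb
    simp only [SimpleGraph.deleteEdges_adj, Set.mem_singleton_iff, Sym2.eq_iff]
    have := SimpleGraph.adj_comm H
    grind
  · grind
  · intro u hu v hv
    simp only [SimpleGraph.deleteEdges_adj, Set.mem_singleton_iff, Sym2.eq_iff]
    grind

/-- Removing a clique vertex or a clique edge lowers the size of the clique by one or two, and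
removing an isolated vertex changes the parity of `Z`. -/
theorem secondWins_iff [Finite V] (h : IsCliqueWithIsolated H S Z Q) :
    SecondWins S H ↔ (Z.card % 2 = 0 ∧ Q.card % 3 = 0) ∨ (Z.card % 2 = 1 ∧ Q.card % 3 = 1) := by
  induction hm : Z.card + Q.card using Nat.strong_induction_on generalizing S Z Q with
  | _ m ih =>
    subst hm
    have eraseZ : ∀ z ∈ Z, (SecondWins (S.erase z) H ↔
        ((Z.card + 1) % 2 = 0 ∧ Q.card % 3 = 0) ∨ ((Z.card + 1) % 2 = 1 ∧ Q.card % 3 = 1)) := by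
      intro z hz
      have hc := Finset.card_erase_add_one hz
      rw [ih _ (by omega) (h.erase_isolated hz) rfl]
      omega
    have eraseQ : ∀ a ∈ Q, (SecondWins (S.erase a) H ↔
        (Z.card % 2 = 0 ∧ (Q.card + 2) % 3 = 0) ∨ (Z.card % 2 = 1 ∧ (Q.card + 2) % 3 = 1)) := by
      intro a ha
      have hc := Finset.card_erase_add_one ha
      rw [ih _ (by omega) (h.erase_clique ha) rfl]
      omega
    have edge : ∀ a ∈ Q, ∀ b ∈ Q, a ≠ b → (SecondWins S (H.deleteEdges {s(a, b)}) ↔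
        (Z.card % 2 = 0 ∧ (Q.card + 1) % 3 = 0) ∨ (Z.card % 2 = 1 ∧ (Q.card + 1) % 3 = 1)) := by
      intro a ha b hb hab
      have hb' : b ∈ Q.erase a := Finset.mem_erase.2 ⟨hab.symm, hb⟩
      have hc := Finset.card_erase_add_one ha
      have hc' := Finset.card_erase_add_one hb'
      rw [h.deleteEdge_iff ha hb hab, ih _ (by omega) ((h.erase_clique ha).erase_clique hb') rfl]
      omega
    constructor
    · contrapose
      intro hne
      by_cases hQ : Q.card = 0
      · obtain ⟨z, hz⟩ := Finset.card_pos.1 (show 0 < Z.card by omega)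
        refine not_secondWins_of_vertex ((h.mem_iff z).2 (Or.inl hz)) ((eraseZ z hz).2 ?_)
        omega
      obtain ⟨a, ha⟩ := Finset.card_pos.1 (Nat.pos_of_ne_zero hQ)
      by_cases h1 : (Q.card + 2) % 3 = Z.card % 2
      · refine not_secondWins_of_vertex ((h.mem_iff a).2 (Or.inr ha)) ((eraseQ a ha).2 ?_)
        omega
      · obtain ⟨a, ha, b, hb, hab⟩ := Finset.one_lt_card.1 (show 1 < Q.card by omega)
        refine not_secondWins_of_edge ((h.mem_iff a).2 (Or.inr ha)) ((h.mem_iff b).2 (Or.inr hb))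
          (h.clique a ha b hb hab) ((edge a ha b hb hab).2 ?_)
        omega
    · intro hval
      refine Chomp.secondWins_iff.2 ⟨fun v hv => ?_, fun u hu v hv huv => ?_⟩
      · rcases (h.mem_iff v).1 hv with hz | hq
        · rw [eraseZ v hz]
          omega
        · rw [eraseQ v hq]
          omega
      · have hu' := ((h.mem_iff u).1 hu).resolve_left fun hz => h.isolated u hz v hv huv
        have hv' := ((h.mem_iff v).1 hv).resolve_left fun hz => h.isolated v hz u hu huv.symm
        rw [edge u hu' v hv' huv.ne]
        omega

end IsCliqueWithIsolated

namespace IsCliqueWithVertex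

theorem erase_vertex (h : IsCliqueWithVertex H S Z Q I w) :
    IsCliqueWithIsolated H (S.erase w) Z Q := by
  obtain ⟨h1, h2, h3, h4, h5, h6, h7, h8⟩ := h
  constructor <;> grind

theorem erase_isolated (h : IsCliqueWithVertex H S Z Q I w) {z : V} (hz : z ∈ Z) :
    IsCliqueWithVertex H (S.erase z) (Z.erase z) Q I w := by
  obtain ⟨h1, h2, h3, h4, h5, h6, h7, h8⟩ := h
  constructor <;> grind

theorem erase_clique (h : IsCliqueWithVertex H S Z Q I w) {a : V} (ha : a ∈ Q) :
    IsCliqueWithVertex H (S.erase a) Z (Q.erase a) (I.erase a) w := by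
  obtain ⟨h1, h2, h3, h4, h5, h6, h7, h8⟩ := h
  constructor <;> grind

theorem deleteEdge_vertex (h : IsCliqueWithVertex H S Z Q I w) (a : V) :
    IsCliqueWithVertex (H.deleteEdges {s(w, a)}) S Z Q (I.erase a) w := by
  obtain ⟨h1, h2, h3, h4, h5, h6, h7, h8⟩ := h
  constructor <;>
    try simp only [SimpleGraph.deleteEdges_adj, Set.mem_singleton_iff, Sym2.eq_iff]
  all_goals grind

/-- After the removal of the clique edge `ab`, the vertices `a` and `b` are twins, provided that
`w` is adjacent to both or to neither. -/
theorem secondWins_deleteEdge_iff [Finite V] (h : IsCliqueWithVertex H S Z Q I w) {a b : V}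
    (ha : a ∈ Q) (hb : b ∈ Q) (hab : a ≠ b) (hI : a ∈ I ↔ b ∈ I) :
    SecondWins S (H.deleteEdges {s(a, b)}) ↔ SecondWins ((S.erase a).erase b) H := by
  obtain ⟨h1, h2, h3, h4, h5, h6, h7, h8⟩ := h
  refine secondWins_erase_twins (a := a) (b := b) ?_ ?_ ?_ ?_ ?_ ?_ hab
  · grind
  · grind
  · simp
  · intro c hc hca hcb
    simp only [SimpleGraph.deleteEdges_adj, Set.mem_singleton_iff, Sym2.eq_iff]
    have := SimpleGraph.adj_comm H
    grind
  · grind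
  · intro u hu v hv
    simp only [SimpleGraph.deleteEdges_adj, Set.mem_singleton_iff, Sym2.eq_iff]
    grind

/-- The position after the removal of a clique edge `ab` and of `w`: it has the outcome of a clique
with two vertices fewer. -/
theorem secondWins_deleteEdge_erase_vertex_iff [Finite V] (h : IsCliqueWithVertex H S Z Q I w)
    {a b : V} (ha : a ∈ Q) (hb : b ∈ Q) (hab : a ≠ b) :
    SecondWins (S.erase w) (H.deleteEdges {s(a, b)}) ↔
      (Z.card % 2 = 0 ∧ (Q.card + 1) % 3 = 0) ∨ (Z.card % 2 = 1 ∧ (Q.card + 1) % 3 = 1) := by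
  have h' := h.erase_vertex
  have hb' : b ∈ Q.erase a := Finset.mem_erase.2 ⟨hab.symm, hb⟩
  have hc := Finset.card_erase_add_one ha
  have hc' := Finset.card_erase_add_one hb'
  rw [h'.deleteEdge_iff ha hb hab, ((h'.erase_clique ha).erase_clique hb').secondWins_iff]
  omega

/-- For `a ∈ I` and `b ∉ I`, the removal of the edge `ab` does not make `a` and `b` twins, but the
further removal of the edge `wa` does. -/
theorem secondWins_deleteEdge_deleteEdge_iff [Finite V] (h : IsCliqueWithVertex H S Z Q I w)
    {a b : V} (ha : a ∈ Q) (hb : b ∈ Q) (hab : a ≠ b) (hbI : b ∉ I) :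
    SecondWins S ((H.deleteEdges {s(a, b)}).deleteEdges {s(w, a)}) ↔
      SecondWins ((S.erase a).erase b) (H.deleteEdges {s(w, a)}) := by
  rw [SimpleGraph.deleteEdges_deleteEdges, Set.union_comm, ← SimpleGraph.deleteEdges_deleteEdges]
  exact (h.deleteEdge_vertex a).secondWins_deleteEdge_iff ha hb hab (by simp [hbI])

/-- All moves but one kind lead to a position of the same shape. The exception is the removal of a
clique edge `ab` with `a ∈ I` and `b ∉ I`; from a position lost for the player to move it is
answered by removing `w`, or the edge `wa`. -/
theorem secondWins_iff [Finite V] (h : IsCliqueWithVertex H S Z Q I w) :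
    SecondWins S H ↔
      (Z.card % 2 = 0 ∧ (Q.card % 3 = 1 ∧ I.card % 3 = 0 ∨ Q.card % 3 = 2 ∧ I.card % 3 = 2)) ∨
      (Z.card % 2 = 1 ∧ (Q.card % 3 = 0 ∧ I.card % 3 = 0 ∨ Q.card % 3 = 2 ∧ I.card % 3 = 1)) := by
  induction hm : Z.card + Q.card + I.card using Nat.strong_induction_on
    generalizing H S Z Q I with
  | _ m ih =>
    subst hm
    have hIQ : I.card ≤ Q.card := Finset.card_le_card h.subset
    have hwS : w ∈ S := (h.mem_iff w).2 (Or.inl rfl)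
    have hQS : ∀ a ∈ Q, a ∈ S := fun a ha => (h.mem_iff a).2 (Or.inr (Or.inr ha))
    have hadj : ∀ a ∈ I, H.Adj w a := fun a ha => (h.adj_iff a (h.subset a ha)).2 ha
    have eraseW := h.erase_vertex.secondWins_iff
    have eraseZ : ∀ z ∈ Z, (SecondWins (S.erase z) H ↔
        (Z.card % 2 = 1 ∧ (Q.card % 3 = 1 ∧ I.card % 3 = 0 ∨ Q.card % 3 = 2 ∧ I.card % 3 = 2)) ∨
        (Z.card % 2 = 0 ∧
          (Q.card % 3 = 0 ∧ I.card % 3 = 0 ∨ Q.card % 3 = 2 ∧ I.card % 3 = 1))) := by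
      intro z hz
      have hc := Finset.card_erase_add_one hz
      rw [ih _ (by omega) (h.erase_isolated hz) rfl]
      omega
    have eraseI : ∀ a ∈ I, (SecondWins (S.erase a) H ↔
        (Z.card % 2 = 0 ∧ (Q.card % 3 = 2 ∧ I.card % 3 = 1 ∨ Q.card % 3 = 0 ∧ I.card % 3 = 0)) ∨
        (Z.card % 2 = 1 ∧
          (Q.card % 3 = 1 ∧ I.card % 3 = 1 ∨ Q.card % 3 = 0 ∧ I.card % 3 = 2))) := by
      intro a ha
      have hc := Finset.card_erase_add_one ha
      have hc' := Finset.card_erase_add_one (h.subset a ha)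
      rw [ih _ (by omega) (h.erase_clique (h.subset a ha)) rfl]
      omega
    have eraseQ : ∀ a ∈ Q, a ∉ I → (SecondWins (S.erase a) H ↔
        (Z.card % 2 = 0 ∧ (Q.card % 3 = 2 ∧ I.card % 3 = 0 ∨ Q.card % 3 = 0 ∧ I.card % 3 = 2)) ∨
        (Z.card % 2 = 1 ∧
          (Q.card % 3 = 1 ∧ I.card % 3 = 0 ∨ Q.card % 3 = 0 ∧ I.card % 3 = 1))) := by
      intro a ha haI
      have hc := Finset.card_erase_add_one ha
      rw [ih _ (by rw [Finset.erase_eq_of_notMem haI]; omega) (h.erase_clique ha) rfl,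
        Finset.erase_eq_of_notMem haI]
      omega
    have edgeW : ∀ a ∈ I, (SecondWins S (H.deleteEdges {s(w, a)}) ↔
        (Z.card % 2 = 0 ∧ (Q.card % 3 = 1 ∧ I.card % 3 = 1 ∨ Q.card % 3 = 2 ∧ I.card % 3 = 0)) ∨
        (Z.card % 2 = 1 ∧
          (Q.card % 3 = 0 ∧ I.card % 3 = 1 ∨ Q.card % 3 = 2 ∧ I.card % 3 = 2))) := by
      intro a ha
      have hc := Finset.card_erase_add_one ha
      rw [ih _ (by omega) (h.deleteEdge_vertex a) rfl]
      omega
    have edgeI : ∀ a ∈ I, ∀ b ∈ I, a ≠ b → (SecondWins S (H.deleteEdges {s(a, b)}) ↔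
        (Z.card % 2 = 0 ∧ (Q.card % 3 = 0 ∧ I.card % 3 = 2 ∨ Q.card % 3 = 1 ∧ I.card % 3 = 1)) ∨
        (Z.card % 2 = 1 ∧
          (Q.card % 3 = 2 ∧ I.card % 3 = 2 ∨ Q.card % 3 = 1 ∧ I.card % 3 = 0))) := by
      intro a ha b hb hab
      have haQ := h.subset a ha
      have hbQ := h.subset b hb
      have hb' : b ∈ Q.erase a := Finset.mem_erase.2 ⟨hab.symm, hbQ⟩
      have hc := Finset.card_erase_add_one haQ
      have hc' := Finset.card_erase_add_one hb'
      have hd := Finset.card_erase_add_one ha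
      have hd' := Finset.card_erase_add_one (Finset.mem_erase.2 ⟨hab.symm, hb⟩ : b ∈ I.erase a)
      rw [h.secondWins_deleteEdge_iff haQ hbQ hab (by simp [ha, hb]),
        ih _ (by omega) ((h.erase_clique haQ).erase_clique hb') rfl]
      omega
    have edgeQ : ∀ a ∈ Q, a ∉ I → ∀ b ∈ Q, b ∉ I → a ≠ b →
        (SecondWins S (H.deleteEdges {s(a, b)}) ↔
        (Z.card % 2 = 0 ∧ (Q.card % 3 = 0 ∧ I.card % 3 = 0 ∨ Q.card % 3 = 1 ∧ I.card % 3 = 2)) ∨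
        (Z.card % 2 = 1 ∧
          (Q.card % 3 = 2 ∧ I.card % 3 = 0 ∨ Q.card % 3 = 1 ∧ I.card % 3 = 1))) := by
      intro a ha haI b hb hbI hab
      have hb' : b ∈ Q.erase a := Finset.mem_erase.2 ⟨hab.symm, hb⟩
      have hc := Finset.card_erase_add_one ha
      have hc' := Finset.card_erase_add_one hb'
      have hI : (I.erase a).erase b = I := by
        rw [Finset.erase_eq_of_notMem haI, Finset.erase_eq_of_notMem hbI]
      rw [h.secondWins_deleteEdge_iff ha hb hab (by simp [haI, hbI]),
        ih _ (by rw [hI]; omega) ((h.erase_clique ha).erase_clique hb') rfl, hI]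
      omega
    constructor
    · contrapose
      intro hne
      by_cases hw : Q.card % 3 = Z.card % 2
      · exact not_secondWins_of_vertex hwS (eraseW.2 (by omega))
      have hQI : (Q \ I).card + I.card = Q.card := Finset.card_sdiff_add_card_eq_card h.subset
      -- the winning moves, according to the residues of the cardinalities; those of `I` and
      -- `Q \ I` also ensure that the elements needed for the move exist
      have viaI : 0 < I.card → (∀ a ∈ I, SecondWins (S.erase a) H) → ¬ SecondWins S H := by
        intro hpos hall
        obtain ⟨a, ha⟩ := Finset.card_pos.1 hpos
        exact not_secondWins_of_vertex (hQS a (h.subset a ha)) (hall a ha)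
      have viaW : 0 < I.card → (∀ a ∈ I, SecondWins S (H.deleteEdges {s(w, a)})) →
          ¬ SecondWins S H := by
        intro hpos hall
        obtain ⟨a, ha⟩ := Finset.card_pos.1 hpos
        exact not_secondWins_of_edge hwS (hQS a (h.subset a ha)) (hadj a ha) (hall a ha)
      have viaQ : 1 < (Q \ I).card →
          (∀ a ∈ Q, a ∉ I → ∀ b ∈ Q, b ∉ I → a ≠ b →
            SecondWins S (H.deleteEdges {s(a, b)})) → ¬ SecondWins S H := by
        intro hpos hall
        obtain ⟨a, ha, b, hb, hab⟩ := Finset.one_lt_card.1 hpos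
        rw [Finset.mem_sdiff] at ha hb
        exact not_secondWins_of_edge (hQS a ha.1) (hQS b hb.1) (h.clique a ha.1 b hb.1 hab)
          (hall a ha.1 ha.2 b hb.1 hb.2 hab)
      have hQ3 := Nat.mod_lt Q.card (show 0 < 3 by decide)
      have hI3 := Nat.mod_lt I.card (show 0 < 3 by decide)
      rcases Nat.mod_two_eq_zero_or_one Z.card with hZ | hZ
      · simp only [hZ, true_and, false_and, or_false, zero_ne_one] at hne hw
        by_cases hq : Q.card % 3 = 1
        · by_cases hi : I.card % 3 = 1
          · exact viaW (by omega) fun a ha => (edgeW a ha).2 (Or.inl ⟨hZ, Or.inl ⟨hq, hi⟩⟩)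
          · have hi' : I.card % 3 = 2 := by omega
            exact viaQ (by omega) fun a ha haI b hb hbI hab =>
              (edgeQ a ha haI b hb hbI hab).2 (Or.inl ⟨hZ, Or.inr ⟨hq, hi'⟩⟩)
        · have hq' : Q.card % 3 = 2 := by omega
          by_cases hi : I.card % 3 = 1
          · exact viaI (by omega) fun a ha => (eraseI a ha).2 (Or.inl ⟨hZ, Or.inl ⟨hq', hi⟩⟩)
          · have hi' : I.card % 3 = 0 := by omega
            obtain ⟨a, ha⟩ := Finset.card_pos.1 (show 0 < (Q \ I).card by omega)
            rw [Finset.mem_sdiff] at ha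
            exact not_secondWins_of_vertex (hQS a ha.1)
              ((eraseQ a ha.1 ha.2).2 (Or.inl ⟨hZ, Or.inl ⟨hq', hi'⟩⟩))
      · simp only [hZ, true_and, false_and, false_or, one_ne_zero] at hne hw
        by_cases hq : Q.card % 3 = 0
        · by_cases hi : I.card % 3 = 1
          · exact viaW (by omega) fun a ha => (edgeW a ha).2 (Or.inr ⟨hZ, Or.inl ⟨hq, hi⟩⟩)
          · have hi' : I.card % 3 = 2 := by omega
            exact viaI (by omega) fun a ha => (eraseI a ha).2 (Or.inr ⟨hZ, Or.inr ⟨hq, hi'⟩⟩)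
        · have hq' : Q.card % 3 = 2 := by omega
          by_cases hi : I.card % 3 = 2
          · obtain ⟨z, hz⟩ := Finset.card_pos.1 (show 0 < Z.card by omega)
            exact not_secondWins_of_vertex ((h.mem_iff z).2 (Or.inr (Or.inl hz)))
              ((eraseZ z hz).2 (Or.inl ⟨hZ, Or.inr ⟨hq', hi⟩⟩))
          · have hi' : I.card % 3 = 0 := by omega
            exact viaQ (by omega) fun a ha haI b hb hbI hab =>
              (edgeQ a ha haI b hb hbI hab).2 (Or.inr ⟨hZ, Or.inl ⟨hq', hi'⟩⟩)
    · intro hval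
      refine Chomp.secondWins_iff.2 ⟨fun v hv => ?_, fun u hu v hv huv => ?_⟩
      · rcases (h.mem_iff v).1 hv with rfl | hz | hq
        · rw [eraseW]
          omega
        · rw [eraseZ v hz]
          omega
        · by_cases hvI : v ∈ I
          · rw [eraseI v hvI]
            omega
          · rw [eraseQ v hq hvI]
            omega
      · obtain ⟨a, ha, he⟩ | ⟨a, ha, b, hb, hab, he, himp⟩ := h.edge_cases hu hv huv
        · rw [he, edgeW a ha]
          omega
        · rw [he]
          by_cases hbI : b ∈ I
          · rw [edgeI a (himp hbI) b hbI hab]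
            omega
          by_cases haI : a ∈ I
          -- the mixed edge: the residue of `Q.card` decides which of the two answers wins
          · by_cases hw : (Q.card + 1) % 3 = Z.card % 2
            · refine not_secondWins_of_vertex hwS
                ((h.secondWins_deleteEdge_erase_vertex_iff ha hb hab).2 ?_)
              omega
            · have hwa : (H.deleteEdges {s(a, b)}).Adj w a := by
                rw [SimpleGraph.deleteEdges_adj]
                refine ⟨hadj a haI, ?_⟩
                have := h.notMem_clique
                rw [Set.mem_singleton_iff, Sym2.eq_iff]
                rintro (⟨rfl, -⟩ | ⟨rfl, -⟩) <;> contradiction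
              refine not_secondWins_of_edge hwS (hQS a ha) hwa ?_
              rw [h.secondWins_deleteEdge_deleteEdge_iff ha hb hab hbI]
              have hb' : b ∈ Q.erase a := Finset.mem_erase.2 ⟨hab.symm, hb⟩
              have hc := Finset.card_erase_add_one ha
              have hc' := Finset.card_erase_add_one hb'
              have hd := Finset.card_erase_add_one haI
              have hI : ((I.erase a).erase a).erase b = I.erase a := by
                rw [Finset.erase_idem, Finset.erase_eq_of_notMem (by simp [hbI])]
              refine (ih _ ?_ (((h.deleteEdge_vertex a).erase_clique ha).erase_clique hb')
                rfl).2 ?_ <;> rw [hI] <;> omega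
          · rw [edgeQ a ha haI b hb hbI hab]
            omega

end IsCliqueWithVertex

end Outcomes

/-! ### The threshold graphs -/

/-- The vertices `u_1, ..., u_n` of the clique. -/
def cliqueVerts (n k : ℕ) : Finset (Fin n ⊕ Fin k) :=
  Finset.univ.map Function.Embedding.inl

/-- The vertices `u_1, ..., u_m` of the clique (all of its vertices if `m ≥ n`). -/
def firstVerts (n k m : ℕ) : Finset (Fin n ⊕ Fin k) :=
  (Finset.univ.filter fun a : Fin n => (a : ℕ) < m).map Function.Embedding.inl

theorem card_cliqueVerts (n k : ℕ) : (cliqueVerts n k).card = n := by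
  simp [cliqueVerts]

theorem card_firstVerts {n m : ℕ} (k : ℕ) (hm : m ≤ n) : (firstVerts n k m).card = m := by
  simp [firstVerts, Fin.card_filter_val_lt, hm]

theorem mem_cliqueVerts {n k : ℕ} {v : Fin n ⊕ Fin k} :
    v ∈ cliqueVerts n k ↔ ∃ a, v = Sum.inl a := by
  simp [cliqueVerts, eq_comm]

theorem mem_firstVerts {n k m : ℕ} {v : Fin n ⊕ Fin k} :
    v ∈ firstVerts n k m ↔ ∃ a : Fin n, (a : ℕ) < m ∧ v = Sum.inl a := by
  simp [firstVerts, eq_comm]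

theorem isCliqueWithVertex_thresholdGraph_one (n i : ℕ) :
    IsCliqueWithVertex (thresholdGraph n ![i]) Finset.univ ∅ (cliqueVerts n 1)
      (firstVerts n 1 i) (Sum.inr 0) := by
  constructor <;> simp [mem_cliqueVerts, mem_firstVerts, thresholdGraph]

theorem isCliqueWithVertex_thresholdGraph_zero (n i : ℕ) :
    IsCliqueWithVertex (thresholdGraph n ![0, i]) Finset.univ {Sum.inr 0} (cliqueVerts n 2)
      (firstVerts n 2 i) (Sum.inr 1) := by
  constructor <;> simp [mem_cliqueVerts, mem_firstVerts, thresholdGraph]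

theorem isCliqueWithVertex_thresholdGraph_erase (n j i : ℕ) :
    IsCliqueWithVertex (thresholdGraph n ![j, i]) (Finset.univ.erase (Sum.inr 0)) ∅
      (cliqueVerts n 2) (firstVerts n 2 i) (Sum.inr 1) := by
  constructor <;> simp [mem_cliqueVerts, mem_firstVerts, thresholdGraph]

theorem isCliqueWithVertex_thresholdGraph_deleteEdge (n i : ℕ) :
    IsCliqueWithVertex ((thresholdGraph (n + 1) ![1, i]).deleteEdges {s(Sum.inr 0, Sum.inl 0)})
      Finset.univ {Sum.inr 0} (cliqueVerts (n + 1) 2) (firstVerts (n + 1) 2 i) (Sum.inr 1) := by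
  constructor <;> simp [mem_cliqueVerts, mem_firstVerts, thresholdGraph]

theorem isCliqueWithVertex_thresholdGraph_erase_clique (n i : ℕ) :
    IsCliqueWithVertex (thresholdGraph (n + 1) ![1, i]) (Finset.univ.erase (Sum.inl 0))
      {Sum.inr 0} ((cliqueVerts (n + 1) 2).erase (Sum.inl 0))
      ((firstVerts (n + 1) 2 i).erase (Sum.inl 0)) (Sum.inr 1) := by
  constructor <;> simp [mem_cliqueVerts, mem_firstVerts, thresholdGraph]
  · exact fun a h _ _ _ => h
  · exact fun a h _ => h

end Chomp

theorem mainTheorem8 (n i : ℕ) (hin : i ≤ n) :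
    -- (i)
    ((Chomp.WinsOn (Chomp.thresholdGraph n ![i]) ChompPlayer.B ↔
        ((n ≡ 1 [MOD 3] ∧ i ≡ 0 [MOD 3]) ∨ (n ≡ 2 [MOD 3] ∧ i ≡ 2 [MOD 3]))) ∧
      (Chomp.WinsOn (Chomp.thresholdGraph n ![i]) ChompPlayer.A ↔
        ¬ ((n ≡ 1 [MOD 3] ∧ i ≡ 0 [MOD 3]) ∨ (n ≡ 2 [MOD 3] ∧ i ≡ 2 [MOD 3])))) ∧
    -- (ii)
    ((Chomp.WinsOn (Chomp.thresholdGraph n ![0, i]) ChompPlayer.B ↔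
        ((n ≡ 0 [MOD 3] ∧ i ≡ 0 [MOD 3]) ∨ (n ≡ 2 [MOD 3] ∧ i ≡ 1 [MOD 3]))) ∧
      (Chomp.WinsOn (Chomp.thresholdGraph n ![0, i]) ChompPlayer.A ↔
        ¬ ((n ≡ 0 [MOD 3] ∧ i ≡ 0 [MOD 3]) ∨ (n ≡ 2 [MOD 3] ∧ i ≡ 1 [MOD 3])))) ∧
    -- (iii)
    (1 ≤ n →
      ((n ≡ 0 [MOD 3] ∧ i ≡ 0 [MOD 3]) ∨ (n ≡ 0 [MOD 3] ∧ i ≡ 2 [MOD 3]) ∨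
        (n ≡ 1 [MOD 3] ∧ i ≡ 0 [MOD 3]) ∨ (n ≡ 1 [MOD 3] ∧ i ≡ 1 [MOD 3]) ∨
        (n ≡ 2 [MOD 3] ∧ i ≡ 1 [MOD 3]) ∨ (n ≡ 2 [MOD 3] ∧ i ≡ 2 [MOD 3])) →
      Chomp.WinsOn (Chomp.thresholdGraph n ![1, i]) ChompPlayer.A) ∧
    -- (iv)
    (∀ j : ℕ, j ≤ n →
      ((n ≡ 1 [MOD 3] ∧ i ≡ 0 [MOD 3]) ∨ (n ≡ 2 [MOD 3] ∧ i ≡ 2 [MOD 3])) →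
      Chomp.WinsOn (Chomp.thresholdGraph n ![j, i]) ChompPlayer.A) := by
  have hone : Chomp.SecondWins Finset.univ (Chomp.thresholdGraph n ![i]) ↔
      (n ≡ 1 [MOD 3] ∧ i ≡ 0 [MOD 3]) ∨ (n ≡ 2 [MOD 3] ∧ i ≡ 2 [MOD 3]) := by
    rw [(Chomp.isCliqueWithVertex_thresholdGraph_one n i).secondWins_iff,
      Chomp.card_cliqueVerts, Chomp.card_firstVerts 1 hin]
    simp [Nat.ModEq]
  have hzero : Chomp.SecondWins Finset.univ (Chomp.thresholdGraph n ![0, i]) ↔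
      (n ≡ 0 [MOD 3] ∧ i ≡ 0 [MOD 3]) ∨ (n ≡ 2 [MOD 3] ∧ i ≡ 1 [MOD 3]) := by
    rw [(Chomp.isCliqueWithVertex_thresholdGraph_zero n i).secondWins_iff,
      Chomp.card_cliqueVerts, Chomp.card_firstVerts 2 hin]
    simp [Nat.ModEq]
  have herase : ∀ j, ((n ≡ 1 [MOD 3] ∧ i ≡ 0 [MOD 3]) ∨ (n ≡ 2 [MOD 3] ∧ i ≡ 2 [MOD 3])) →
      Chomp.WinsOn (Chomp.thresholdGraph n ![j, i]) ChompPlayer.A := by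
    intro j hval
    rw [Chomp.winsOn_A_iff Finset.mem_univ]
    refine Chomp.not_secondWins_of_vertex (Finset.mem_univ (Sum.inr 0)) ?_
    rw [(Chomp.isCliqueWithVertex_thresholdGraph_erase n j i).secondWins_iff,
      Chomp.card_cliqueVerts, Chomp.card_firstVerts 2 hin]
    simpa [Nat.ModEq] using hval
  refine ⟨⟨?_, ?_⟩, ⟨?_, ?_⟩, fun hn hval => ?_, fun j _ => herase j⟩
  · rw [Chomp.winsOn_B_iff Finset.mem_univ, hone]
  · rw [Chomp.winsOn_A_iff Finset.mem_univ, hone]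
  · rw [Chomp.winsOn_B_iff Finset.mem_univ, hzero]
  · rw [Chomp.winsOn_A_iff Finset.mem_univ, hzero]
  -- the winning first move is to remove the vertex `Sum.inr 0`, its only edge, or `u_1`
  · obtain ⟨n, rfl⟩ : ∃ m, n = m + 1 := ⟨n - 1, by omega⟩
    by_cases h1 : ((n + 1 ≡ 1 [MOD 3] ∧ i ≡ 0 [MOD 3]) ∨ (n + 1 ≡ 2 [MOD 3] ∧ i ≡ 2 [MOD 3]))
    · exact herase 1 h1
    rw [Chomp.winsOn_A_iff Finset.mem_univ]
    simp only [Nat.ModEq] at hval h1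
    by_cases h2 : (n + 1) % 3 = 0 ∧ i % 3 = 0 ∨ (n + 1) % 3 = 2 ∧ i % 3 = 1
    · refine Chomp.not_secondWins_of_edge (Finset.mem_univ (Sum.inr 0))
        (Finset.mem_univ (Sum.inl 0)) (by simp [Chomp.thresholdGraph]) ?_
      rw [(Chomp.isCliqueWithVertex_thresholdGraph_deleteEdge n i).secondWins_iff,
        Chomp.card_cliqueVerts, Chomp.card_firstVerts 2 hin]
      exact Or.inr ⟨by simp, h2⟩
    · refine Chomp.not_secondWins_of_vertex (Finset.mem_univ (Sum.inl 0)) ?_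
      have hQ := Finset.card_erase_of_mem
        (Chomp.mem_cliqueVerts.2 ⟨0, rfl⟩ : Sum.inl 0 ∈ Chomp.cliqueVerts (n + 1) 2)
      have hI := Finset.card_erase_of_mem
        (Chomp.mem_firstVerts.2 ⟨0, by simp; omega, rfl⟩ :
          Sum.inl 0 ∈ Chomp.firstVerts (n + 1) 2 i)
      rw [Chomp.card_cliqueVerts] at hQ
      rw [Chomp.card_firstVerts 2 hin] at hI
      rw [(Chomp.isCliqueWithVertex_thresholdGraph_erase_clique n i).secondWins_iff, hQ, hI]
      refine Or.inr ⟨by simp, ?_⟩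
      omega
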